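/- **Setting.** Let $V$ be a commutative unital quantale (a complete lattice with a commutative monoid structure $(\otimes,k)$ such that $\otimes$ preserves suprema in each variable; $u\otimes v\le w\iff v\le\hom(u,w)$) with $k\neq\bot$, and assume that $V$ is constructively completely distributive, i.e. the map $\bigvee$ from the down-closed subsets of $V$ to $V$ has a left adjoint. A $V$-matrix $r:X\nrightarrow Y$ is a map $X\times Y\to V$; matrices are ordered pointwise and composed by $(s\cdot r)(x,z)=\bigvee_y r(x,y)\otimes s(y,z)$, $r^\circ$ is the transpose, and a map $f$ is identified with the matrix that is $k$ on its graph and $\bot$ elsewhere. Let $\mathbb T=(T,e,m)$ be a monad on $\mathbf{Set}$ that is non-trivial (neither the monad with $TX=1$ for all $X$ nor the one with $T\varnothing=\varnothing$ and $TX=1$ for $X\ne\varnothing$), such that $T$ sends pullbacks to weak pullbacks and each naturality square of $m$ is a weak pullback. Extend $T$ to relations by $TR=Tp\cdot (Tq)^\circ$, where $q:R\to X$ and $p:R\to Y$ are the projections of $R\subseteq X\times Y$, and to $V$-matrices $a:X\nrightarrow Y$ by $$Ta(\mathfrak x,\mathfrak y)=\bigvee\{v\in V\mid T(a_v)(\mathfrak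 x,\mathfrak y)\},\qquad a_v(x,y)\iff v\le a(x,y).$$ A *$(\mathbb T,V)$-category* is a set $X$ with $a:TX\nrightarrow X$ such that $k\le a(e_X(x),x)$ and $Ta(\mathfrak X,\mathfrak x)\otimes a(\mathfrak x,x)\le a(m_X(\mathfrak X),x)$. A *$(\mathbb T,V)$-functor* $f:(X,a)\to(Y,b)$ is a map with $a(\mathfrak x,x)\le b(Tf(\mathfrak x),f(x))$. For $a:TX\nrightarrow Y$ and $b:TY\nrightarrow Z$ put $b*a=b\cdot Ta\cdot m_X^\circ$. A *bimodule* $\psi:(X,a)\nrightarrow (Y,b)$ is a matrix $\psi:TX\nrightarrow Y$ with $\psi*a\le\psi$ and $b*\psi\le\psi$. Bimodules $\varphi:(Y,b)\nrightarrow (X,a)$ and $\psi:(X,a)\nrightarrow (Y,b)$ are *adjoint*, $\varphi\dashv\psi$, if $b\le\psi*\varphi$ and $\varphi*\psi\le a$. The pair is *induced* by a $(\mathbb T,V)$-functor $f:(Y,b)\to(X,a)$ if $\varphi=f_*:=a\cdot Tf$ and $\psi=f^*:=f^\circ\cdot a$. The $(\mathbb T,V)$-category $(X,a)$ is *Lawvere-complete*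 if, for every $(\mathbb T,V)$-category $(Y,b)$, every adjoint pair $\varphi\dashv\psi$ as above is induced by some $(\mathbb T,V)$-functor $f:(Y,b)\to(X,a)$. Write $p=e_1^\circ:T1\nrightarrow 1$ for the structure of the one-point $(\mathbb T,V)$-category $(1,p)$, $1=\{\star\}$. Let $\xi:TV\to V$, $\xi(\mathfrak x)=\bigvee\{v\in V\mid\mathfrak x\in T(\uparrow v)\}$, where $\uparrow v=\{u\in V\mid v\le u\}$ and $T(\uparrow v)$ is regarded as a subset of $TV$, and let $\hom_\xi=\hom\cdot\xi:TV\nrightarrow V$, i.e. $\hom_\xi(\mathfrak v,w)=\hom(\xi(\mathfrak v),w)$. Assume finally that for all $\mathfrak w\in T(V\times V)$ $$\xi(T\pi_1(\mathfrak w))\otimes\xi(T\pi_2(\mathfrak w))=\xi(T(\otimes)(\mathfrak w)).$$ **Theorem.** Assume that $T1=1$ and that $T(\hom_\xi)\cdot m_V^\circ=\xi^\circ\cdot\hom\cdot\xi$, i.e. that for all $\mathfrak v,\mathfrak w\in TV$ one has $\bigvee_{m_V(\mathfrak V)=\mathfrak v}T(\hom_\xi)(\mathfrak V,\mathfrak w)=\hom(\xi(\mathfrak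 v),\xi(\mathfrak w))$. Then $(V,\hom_\xi)$ is a Lawvere-complete $(\mathbb T,V)$-category. Moreover, every adjoint pair of bimodules $(\varphi:(1,p)\nrightarrow (V,\hom_\xi))\dashv(\psi:(V,\hom_\xi)\nrightarrow (1,p))$ is represented by $\psi(e_V(k),\star)\in V$: it is induced by the $(\mathbb T,V)$-functor $(1,p)\to(V,\hom_\xi)$ with value $\psi(e_V(k),\star)$. -/

import Mathlib

open CategoryTheory

universe u

namespace TVCategory

/-- Constructive complete distributivity: the map sending a down-closed subset of `V` to its
supremum has a left adjoint. -/
def IsCCD (V : Type u) [CompleteLattice V] : Prop :=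
  ∃ l : V → LowerSet V, GaloisConnection l (fun S : LowerSet V => sSup (S : Set V))

section Matrices

variable {V : Type u}

/-- A `V`-matrix from `X` to `Y`, i.e. a map `X × Y → V`; matrices carry the pointwise order. -/
abbrev VMat (V X Y : Type u) : Type u := X → Y → V

/-- Composition of `V`-matrices: `comp s r` is `s · r` (first `r`, then `s`). -/
def comp [CommMonoid V] [CompleteLattice V] {X Y Z : Type u}
    (s : VMat V Y Z) (r : VMat V X Y) : VMat V X Z :=
  fun x z => ⨆ y, r x y * s y z

/-- The transpose `r°`. -/
def transpose {X Y : Type u} (r : VMat V X Y) : VMat V Y X := fun y x => r x y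

open Classical in
/-- The `V`-matrix of a map: the unit `k = 1` on its graph, and `⊥` elsewhere. -/
noncomputable def graph (V : Type u) [CommMonoid V] [CompleteLattice V] {X Y : Type u}
    (f : X → Y) : VMat V X Y :=
  fun x y => if f x = y then 1 else ⊥

/-- The internal hom of the quantale as a `V`-matrix: `hom u w` is the largest `v` with
`u ⊗ v ≤ w`. -/
def homMat (V : Type u) [CommMonoid V] [CompleteLattice V] : VMat V V V :=
  fun v w => Quantale.rightMulResiduation v w

end Matrices

/-- A commutative square `f ≫ h = g ≫ k` is a weak pullback: cones factor through it, not
necessarily uniquely. -/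
def IsWeakPullback {C : Type*} [Category C] {P X Y Z : C}
    (f : P ⟶ X) (g : P ⟶ Y) (h : X ⟶ Z) (k : Y ⟶ Z) : Prop :=
  ∃ w : f ≫ h = g ≫ k, Nonempty (Limits.IsWeakLimit (Limits.PullbackCone.mk f g w))

/-- (BC) for an endofunctor: it sends pullbacks to weak pullbacks. -/
def FunctorBC (F : Type u ⥤ Type u) : Prop :=
  ∀ ⦃P X Y Z : Type u⦄ (f : P ⟶ X) (g : P ⟶ Y) (h : X ⟶ Z) (k : Y ⟶ Z),
    IsPullback f g h k → IsWeakPullback (F.map f) (F.map g) (F.map h) (F.map k)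

/-- (BC) for a natural transformation: each naturality square is a weak pullback. -/
def NatTransBC {F G : Type u ⥤ Type u} (α : F ⟶ G) : Prop :=
  ∀ ⦃X Y : Type u⦄ (f : X ⟶ Y),
    IsWeakPullback (F.map f) (α.app X) (α.app Y) (G.map f)

/-- The two trivial monads on sets: the one with `T X = 1` for all `X`, and the one with
`T ∅ = ∅` and `T X = 1` for all nonempty `X` (up to isomorphism). -/
def IsTrivialMonad (T : CategoryTheory.Monad (Type u)) : Prop :=
  (∀ X : Type u, Nonempty (Unique (T.obj X))) ∨
  ((∀ X : Type u, IsEmpty X → IsEmpty (T.obj X)) ∧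
    ∀ X : Type u, Nonempty X → Nonempty (Unique (T.obj X)))

variable (T : CategoryTheory.Monad (Type u))

/-- The action `T f : T X → T Y` on maps. -/
def tmap {X Y : Type u} (f : X → Y) : T.obj X → T.obj Y := T.map (↾f)

/-- The unit `e_X : X → T X`. -/
def unit (X : Type u) : X → T.obj X := T.η.app X

/-- The multiplication `m_X : T T X → T X`. -/
def mult (X : Type u) : T.obj (T.obj X) → T.obj X := T.μ.app X

/-- The extension of `T` to relations: a relation `R`, seen as a span `X ← R → Y` with
projections `q`, `p`, is sent to `T p · (T q)°`. -/
def relExt {X Y : Type u} (R : X → Y → Prop) (x : T.obj X) (y : T.obj Y) : Prop :=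
  ∃ w : T.obj {z : X × Y // R z.1 z.2},
    tmap T (fun z => z.1.1) w = x ∧ tmap T (fun z => z.1.2) w = y

variable {V : Type u} [CommMonoid V] [CompleteLattice V]

/-- The extension of `T` to `V`-matrices: `T a (𝔵, 𝔶)` is the join of all `v` such that
`T (a_v) (𝔵, 𝔶)` holds, where `a_v (x, y)` means `v ≤ a (x, y)`. -/
def matExt {X Y : Type u} (a : VMat V X Y) : VMat V (T.obj X) (T.obj Y) :=
  fun x y => sSup {v : V | relExt T (fun x' y' => v ≤ a x' y') x y}

/-- `(X, a)` with `a : T X ⇸ X` is a `(T, V)`-category. -/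
structure IsTVCat {X : Type u} (a : VMat V (T.obj X) X) : Prop where
  refl : ∀ x : X, 1 ≤ a (unit T X x) x
  trans : ∀ (A : T.obj (T.obj X)) (b : T.obj X) (x : X),
    matExt T a A b * a b x ≤ a (mult T X A) x

/-- `f : (X, a) → (Y, b)` is a `(T, V)`-functor. -/
def IsTVFunctor {X Y : Type u} (a : VMat V (T.obj X) X) (b : VMat V (T.obj Y) Y)
    (f : X → Y) : Prop :=
  ∀ (A : T.obj X) (x : X), a A x ≤ b (tmap T f A) (f x)

/-- The matrix `T a · m_X° : T X ⇸ T Y`, for `a : T X ⇸ Y`. For a `(T, V)`-category `(X, a)`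
this is the structure of the `V`-category `M° (X, a)` on `T X`. -/
noncomputable def mCirc {X Y : Type u} (a : VMat V (T.obj X) Y) :
    VMat V (T.obj X) (T.obj Y) :=
  comp (matExt T a) (transpose (graph V (mult T X)))

/-- Kleisli composition `b ∗ a = b · T a · m_X°`. -/
noncomputable def kleisli {X Y Z : Type u} (b : VMat V (T.obj Y) Z) (a : VMat V (T.obj X) Y) :
    VMat V (T.obj X) Z :=
  comp b (mCirc T a)

/-- `ψ : T X ⇸ Y` is a `(T, V)`-bimodule `(X, a) ⇸ (Y, b)`. -/
structure IsBimodule {X Y : Type u} (a : VMat V (T.obj X) X) (b : VMat V (T.obj Y) Y)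
    (ψ : VMat V (T.obj X) Y) : Prop where
  right_le : kleisli T ψ a ≤ ψ
  left_le : kleisli T b ψ ≤ ψ

/-- `φ : (X, a) ⇸ (Y, b)` is left adjoint to `ψ : (Y, b) ⇸ (X, a)`; the structures `a` and `b`
are the identities for Kleisli composition of bimodules. -/
structure IsAdjoint {X Y : Type u} (a : VMat V (T.obj X) X) (b : VMat V (T.obj Y) Y)
    (φ : VMat V (T.obj X) Y) (ψ : VMat V (T.obj Y) X) : Prop where
  left_bimodule : IsBimodule T a b φ
  right_bimodule : IsBimodule T b a ψ
  unit_le : a ≤ kleisli T ψ φ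
  counit_le : kleisli T φ ψ ≤ b

/-- `f_* = b · T f`, for `f : X → Y` and `b : T Y ⇸ Y`. -/
noncomputable def lowerStar {X Y : Type u} (b : VMat V (T.obj Y) Y) (f : X → Y) :
    VMat V (T.obj X) Y :=
  comp b (graph V (tmap T f))

/-- `f^* = f° · b`, for `f : X → Y` and `b : T Y ⇸ Y`. -/
noncomputable def upperStar {X Y : Type u} (b : VMat V (T.obj Y) Y) (f : X → Y) :
    VMat V (T.obj Y) X :=
  comp (transpose (graph V f)) b

/-- The adjoint pair `φ ⊣ ψ : (X, a) ⇄ (Y, b)` is induced by the `(T, V)`-functor `f`. -/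
structure IsInducedBy {X Y : Type u} (a : VMat V (T.obj X) X) (b : VMat V (T.obj Y) Y)
    (φ : VMat V (T.obj X) Y) (ψ : VMat V (T.obj Y) X) (f : X → Y) : Prop where
  isTVFunctor : IsTVFunctor T a b f
  lowerStar_eq : lowerStar T b f = φ
  upperStar_eq : upperStar T b f = ψ

/-- Lawvere completeness of `(X, a)`: every adjoint pair of bimodules from a
`(T, V)`-category `(Y, b)` to `(X, a)` is induced by a `(T, V)`-functor. -/
def IsLawvereComplete {X : Type u} (a : VMat V (T.obj X) X) : Prop :=
  ∀ (Y : Type u) (b : VMat V (T.obj Y) Y), IsTVCat T b →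
    ∀ (φ : VMat V (T.obj Y) X) (ψ : VMat V (T.obj X) Y), IsAdjoint T b a φ ψ →
      ∃ f : Y → X, IsInducedBy T b a φ ψ f

/-- The structure `p = e_1°` on the one-point set. -/
noncomputable def point (V : Type u) [CommMonoid V] [CompleteLattice V] :
    VMat V (T.obj PUnit.{u + 1}) PUnit.{u + 1} :=
  transpose (graph V (unit T PUnit.{u + 1}))

/-- `ξ : T V → V`, `ξ 𝔵 = ⋁ {v | 𝔵 ∈ T (↑v)}`, where `T (↑v)` is regarded as a subset of `T V`
through the image of the inclusion `↑v ↪ V`. -/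
def xi (V : Type u) [CompleteLattice V] (x : T.obj V) : V :=
  sSup {v : V | x ∈ Set.range (tmap T (Subtype.val : Set.Ici v → V))}

/-- `hom_ξ = hom · ξ : T V ⇸ V`. -/
noncomputable def homXi (V : Type u) [CommMonoid V] [CompleteLattice V] :
    VMat V (T.obj V) V :=
  comp (homMat V) (graph V (xi T V))

end TVCategory

open TVCategory

/-! Write `k` for the unit `1` of `V`. It suffices to show that the right adjoint `ψ` is
representable: `ψ w y = hom (ξ w) c` with `c = ψ (e k) y` (`IsAdjoint.eq_homXi`). Then `y ↦ c` is a
functor inducing the pair, by a formal argument valid for every `(X, a)` (`IsAdjoint.isInducedBy`).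

By `hM`, the bimodule law for `ψ` reads `hom (ξ w) (ξ w') ⊗ ψ w' y ≤ ψ w y`. Since `ξ (e k) = k`,
the case `w = e k` gives `ψ w' y ≤ hom (ξ w') c`. Conversely, the counit gives `c ⊗ φ (e y) v ≤ v`,
which the compatibility of `ξ` with `⊗` lifts to `c ⊗ ξ (T(φ (e y)) w') ≤ ξ w'`. As `T1 = 1` and
(BC) for `m` make `e (e y)` the only element over `e y`, the adjunction unit at `e y` involves `φ`
only through these values (`mCirc_unit_le`), and it closes the estimate. -/

namespace TVCategory

/-! ### Residuation, and matrices composed with maps -/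

section Quantale

variable {V : Type u} [CommMonoid V] [CompleteLattice V] [IsQuantale V]

theorem le_homMat_iff {u v w : V} : u ≤ homMat V v w ↔ v * u ≤ w :=
  Quantale.rightMulResiduation_le_iff_mul_le

theorem mul_homMat_le (v w : V) : v * homMat V v w ≤ w :=
  le_homMat_iff.1 le_rfl

theorem homMat_one_left (w : V) : homMat V 1 w = w :=
  eq_of_forall_le_iff fun u => by rw [le_homMat_iff, one_mul]

theorem homMat_mul_homMat_le (u v w : V) : homMat V u v * homMat V v w ≤ homMat V u w := by
  rw [le_homMat_iff, ← mul_assoc]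
  exact (mul_le_mul_left (mul_homMat_le u v) _).trans (mul_homMat_le v w)

theorem comp_graph {X Y Z : Type u} (s : VMat V Y Z) (f : X → Y) (x : X) (z : Z) :
    comp s (graph V f) x z = s (f x) z := by
  apply le_antisymm
  · refine iSup_le fun y => ?_
    by_cases h : f x = y
    · simp [graph, h]
    · simp [graph, h, Quantale.bot_mul]
  · refine le_trans ?_ (le_iSup (fun y => graph V f x y * s y z) (f x))
    simp [graph]

theorem comp_transpose_graph {X Y Z : Type u} (r : VMat V X Y) (f : Z → Y) (x : X) (z : Z) :
    comp (transpose (graph V f)) r x z = r x (f z) := by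
  apply le_antisymm
  · refine iSup_le fun y => ?_
    by_cases h : f z = y
    · simp [transpose, graph, h]
    · simp [transpose, graph, h, Quantale.mul_bot]
  · refine le_trans ?_ (le_iSup (fun y => r x y * transpose (graph V f) y z) (f z))
    simp [transpose, graph]

end Quantale

/-! ### Consequences of (BC), non-triviality and `T1 = 1` -/

section Functor

variable (T : CategoryTheory.Monad (Type u))

theorem tmap_comp_apply {X Y Z : Type u} (f : X → Y) (g : Y → Z) (x : T.obj X) :
    tmap T g (tmap T f x) = tmap T (fun a => g (f a)) x :=
  (T.toFunctor.map_comp_apply (↾f) (↾g) x).symm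

theorem tmap_id_apply {X : Type u} (x : T.obj X) : tmap T (fun a : X => a) x = x :=
  T.toFunctor.map_id_apply X x

theorem tmap_unit {X Y : Type u} (f : X → Y) (x : X) :
    tmap T f (unit T X x) = unit T Y (f x) :=
  (NatTrans.naturality_apply T.η (↾f) x).symm

theorem mult_unit {X : Type u} (x : T.obj X) : mult T X (unit T (T.obj X) x) = x :=
  types_congr_hom (T.left_unit X) x

theorem mult_tmap_unit {X : Type u} (x : T.obj X) : mult T X (tmap T (unit T X) x) = x :=
  types_congr_hom (T.right_unit X) x

theorem IsWeakPullback.exists_apply_eq {P X Y Z : Type u} {f : P ⟶ X} {g : P ⟶ Y} {h : X ⟶ Z}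
    {k : Y ⟶ Z} (H : IsWeakPullback f g h k) {x : X} {y : Y} (hxy : h x = k y) :
    ∃ p : P, f p = x ∧ g p = y := by
  obtain ⟨w, ⟨l⟩⟩ := H
  let s : Limits.PullbackCone h k :=
    Limits.PullbackCone.mk (W := PUnit) (↾fun _ => x) (↾fun _ => y) (by ext; exact hxy)
  exact ⟨l.lift s PUnit.unit,
    types_congr_hom (l.fac s Limits.WalkingCospan.left) PUnit.unit,
    types_congr_hom (l.fac s Limits.WalkingCospan.right) PUnit.unit⟩

variable {T}

/-- `T` preserves inverse images of subsets. -/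
theorem mem_range_tmap_preimage (hT : FunctorBC T.toFunctor) {X Y : Type u} (f : X → Y)
    (S : Set Y) {x : T.obj X}
    (hx : tmap T f x ∈ Set.range (tmap T (Subtype.val : S → Y))) :
    x ∈ Set.range (tmap T (Subtype.val : (f ⁻¹' S : Set X) → X)) := by
  obtain ⟨s, hs⟩ := hx
  have hp : IsPullback (↾(Subtype.val : (f ⁻¹' S : Set X) → X))
      (↾(fun a => ⟨f a.1, a.2⟩ : (f ⁻¹' S : Set X) → S)) (↾f) (↾(Subtype.val : S → Y)) := by
    rw [Limits.Types.isPullback_iff]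
    refine ⟨rfl, fun a b h => Subtype.ext h.1, fun a b h => ?_⟩
    have h' : f a = b.1 := h
    exact ⟨⟨a, show f a ∈ S from h' ▸ b.2⟩, rfl, Subtype.ext h'⟩
  obtain ⟨p, hp, -⟩ := (hT _ _ _ _ hp).exists_apply_eq hs.symm
  exact ⟨p, hp⟩

theorem tmap_mem_range {X Y : Type u} (f : X → Y) {S : Set X} {S' : Set Y}
    (h : ∀ a ∈ S, f a ∈ S') {x : T.obj X}
    (hx : x ∈ Set.range (tmap T (Subtype.val : S → X))) :
    tmap T f x ∈ Set.range (tmap T (Subtype.val : S' → Y)) := by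
  obtain ⟨s, rfl⟩ := hx
  refine ⟨tmap T (fun a => ⟨f a.1, h a.1 a.2⟩ : S → S') s, ?_⟩
  rw [tmap_comp_apply, tmap_comp_apply]

theorem unit_mem_range {X : Type u} {S : Set X} {x : X} (hx : x ∈ S) :
    unit T X x ∈ Set.range (tmap T (Subtype.val : S → X)) :=
  ⟨unit T S ⟨x, hx⟩, tmap_unit T _ _⟩

/-- If two distinct points of some set are identified by the unit, then `T` is trivial. -/
theorem isTrivialMonad_of_unit_eq {X : Type u} {x y : X} (hxy : x ≠ y)
    (h : unit T X x = unit T X y) : IsTrivialMonad T := by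
  classical
  have hs : ∀ Y : Type u, Subsingleton (T.obj Y) := fun Y => ⟨fun a b => by
    -- Every map `g` into the free algebra `T Y` factors through the unit, so it cannot separate `x`
    -- from `y`.
    let g : X → T.obj Y := fun z => if z = x then a else b
    have e : ∀ z, mult T Y (tmap T g (unit T X z)) = g z := fun z => by
      rw [tmap_unit, mult_unit]
    have hg : g x = g y := by rw [← e x, ← e y, h]
    simpa [g, hxy.symm] using hg⟩
  have hu : ∀ Y : Type u, Nonempty (T.obj Y) → Nonempty (Unique (T.obj Y)) := fun Y ⟨a⟩ =>
    haveI := hs Y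
    ⟨uniqueOfSubsingleton a⟩
  -- Whether `T∅` is inhabited decides which of the two trivial monads occurs.
  by_cases h0 : Nonempty (T.obj PEmpty.{u + 1})
  · exact Or.inl fun Y => hu Y (h0.map (tmap T PEmpty.elim))
  · refine Or.inr ⟨fun Y hY => ⟨fun a => h0 ⟨tmap T (fun z => (hY.false z).elim) a⟩⟩,
      fun Y ⟨a⟩ => hu Y ⟨unit T Y a⟩⟩

/-- The characteristic map of `S` is constant on `S`, so it sends the image of `T S` through `T1 =
1` to `e true`. If `x ∉ S`, it also sends `e x` to `e false`, and the two would coincide. -/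
theorem unit_mem_range_iff (hT : ¬ IsTrivialMonad T) [Subsingleton (T.obj PUnit.{u + 1})]
    {X : Type u} {S : Set X} {x : X} :
    unit T X x ∈ Set.range (tmap T (Subtype.val : S → X)) ↔ x ∈ S := by
  classical
  refine ⟨fun ⟨s, hs⟩ => ?_, unit_mem_range⟩
  by_contra hx
  let c : X → ULift.{u} Bool := fun z => ⟨decide (z ∈ S)⟩
  refine hT (isTrivialMonad_of_unit_eq (T := T) (x := ULift.up false) (y := ULift.up true)
    (by simp) ?_)
  have hcs : (fun a : S => c a.1) = fun a => (fun _ : PUnit.{u + 1} => ULift.up true)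
      ((fun _ => PUnit.unit) a) := by
    funext a
    simp [c, a.2]
  have hcx : c x = ⟨false⟩ := by simp [c, hx]
  rw [← hcx, ← tmap_unit T c, ← hs, tmap_comp_apply, hcs, ← tmap_comp_apply T (fun _ : S => PUnit.unit)
      (fun _ : PUnit.{u + 1} => ULift.up true),
    Subsingleton.elim (tmap T _ s) (unit T PUnit PUnit.unit), tmap_unit]

theorem subsingleton_obj_obj_punit [Subsingleton (T.obj PUnit.{u + 1})] :
    Subsingleton (T.obj (T.obj PUnit.{u + 1})) := ⟨fun a b => by
  have h : ∀ c : T.obj (T.obj PUnit.{u + 1}), c = tmap T (fun _ => unit T _ PUnit.unit)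
      (unit T PUnit.{u + 1} PUnit.unit) := fun c => by
    rw [← Subsingleton.elim (tmap T (fun _ => PUnit.unit) c) (unit T _ _), tmap_comp_apply]
    -- The identity of `T1` is constant, so every `c` is the image of the single element of `T1`.
    conv_lhs => rw [← tmap_id_apply T c]
    congr 1
    exact funext fun _ => Subsingleton.elim _ _
  rw [h a, h b]⟩

/-- If `T1 = 1` and `m` satisfies (BC), then `e (e y)` is the only element over `e y`. -/
theorem eq_unit_unit_of_mult_eq (hm : NatTransBC T.μ) [Subsingleton (T.obj PUnit.{u + 1})]
    {Y : Type u} {y : Y} {A : T.obj (T.obj Y)} (hA : mult T Y A = unit T Y y) :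
    A = unit T (T.obj Y) (unit T Y y) := by
  have : Subsingleton (T.obj (T.obj PUnit.{u + 1})) := subsingleton_obj_obj_punit
  have h : mult T Y A = tmap T (fun _ : PUnit.{u + 1} => y) (unit T _ PUnit.unit) := by
    rw [hA, tmap_unit]
  -- (BC) at the point `y : 1 → Y` lifts `A` to `TT1`, which has only one element.
  obtain ⟨p, hp, -⟩ := (hm (↾fun _ : PUnit.{u + 1} => y)).exists_apply_eq h
  have hp' : tmap T (tmap T fun _ : PUnit.{u + 1} => y) p = A := hp
  rw [← hp', Subsingleton.elim p (unit T _ (unit T _ PUnit.unit)), tmap_unit, tmap_unit]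

end Functor
end TVCategory
namespace TVCategory

/-! ### The map `ξ`, the matrix extension and Kleisli composition -/

section Extension

variable {T : CategoryTheory.Monad (Type u)} {V : Type u} [CommMonoid V] [CompleteLattice V]

theorem le_xi {v : V} {x : T.obj V}
    (h : x ∈ Set.range (tmap T (Subtype.val : Set.Ici v → V))) : v ≤ xi T V x :=
  le_sSup h

theorem xi_unit (hT : ¬ IsTrivialMonad T) [Subsingleton (T.obj PUnit.{u + 1})] (v : V) :
    xi T V (unit T V v) = v :=
  le_antisymm (sSup_le fun _ h => (unit_mem_range_iff hT).1 h) (le_xi (unit_mem_range le_rfl))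

theorem xi_tmap_mono (hT : FunctorBC T.toFunctor) {X : Type u} {f g : X → V} (h : ∀ x, f x ≤ g x)
    (x : T.obj X) : xi T V (tmap T f x) ≤ xi T V (tmap T g x) :=
  sSup_le fun _ hv => le_xi <|
    tmap_mem_range g (fun a ha => le_trans ha (h a)) (mem_range_tmap_preimage hT f _ hv)

theorem le_xi_tmap_const (v : V) {X : Type u} (x : T.obj X) :
    v ≤ xi T V (tmap T (fun _ => v) x) :=
  le_xi (tmap_mem_range (S := Set.univ) _ (fun _ _ => le_rfl)
    ⟨tmap T (fun a => ⟨a, trivial⟩) x, by rw [tmap_comp_apply, tmap_id_apply]⟩)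

theorem le_matExt_tmap {X Y Z : Type u} {a : VMat V X Y} {v : V} {f : Z → X} {g : Z → Y}
    (h : ∀ z, v ≤ a (f z) (g z)) (z : T.obj Z) : v ≤ matExt T a (tmap T f z) (tmap T g z) :=
  le_sSup ⟨tmap T (fun z => ⟨(f z, g z), h z⟩) z, tmap_comp_apply T _ _ _,
    tmap_comp_apply T _ _ _⟩

theorem le_matExt_unit {X Y : Type u} (a : VMat V X Y) (x : X) (y : Y) :
    a x y ≤ matExt T a (unit T X x) (unit T Y y) := by
  rw [← tmap_unit T (fun _ : PUnit.{u + 1} => x) PUnit.unit,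
    ← tmap_unit T (fun _ : PUnit.{u + 1} => y) PUnit.unit]
  exact le_matExt_tmap (fun _ => le_rfl) _

/-- A witness over `e x` lives on the fibre of the relation over `x`, because `T` preserves inverse
images; on that fibre `v ≤ a x`. -/
theorem matExt_unit_le (hT : FunctorBC T.toFunctor) {X : Type u} (a : VMat V X V) (x : X)
    (w : T.obj V) : matExt T a (unit T X x) w ≤ xi T V (tmap T (a x) w) := by
  refine sSup_le fun v ⟨q, hq, hw⟩ => le_xi ?_
  have h := mem_range_tmap_preimage hT
    (fun z : {z : X × V // v ≤ a z.1 z.2} => z.1.1) {x} (x := q)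
    (by rw [hq]; exact unit_mem_range rfl)
  rw [← hw, tmap_comp_apply]
  refine tmap_mem_range _ (fun z hz => ?_) h
  have hz' : z.1.1 = x := hz
  have := z.2
  rwa [hz'] at this

variable [IsQuantale V]

theorem mCirc_apply {X Y : Type u} (a : VMat V (T.obj X) Y) (x : T.obj X) (y : T.obj Y) :
    mCirc T a x y = ⨆ A : {A // mult T X A = x}, matExt T a A.1 y := by
  apply le_antisymm
  · refine iSup_le fun A => ?_
    by_cases h : mult T X A = x
    · refine le_trans ?_ (le_iSup (fun A : {A // mult T X A = x} => matExt T a A.1 y) ⟨A, h⟩)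
      simp [transpose, graph, h]
    · simp [transpose, graph, h, Quantale.bot_mul]
  · refine iSup_le fun A => ?_
    refine le_trans ?_ (le_iSup (fun B => transpose (graph V (mult T X)) x B * matExt T a B y) A.1)
    simp [transpose, graph, A.2]

theorem matExt_le_mCirc {X Y : Type u} (a : VMat V (T.obj X) Y) (A : T.obj (T.obj X))
    (y : T.obj Y) : matExt T a A y ≤ mCirc T a (mult T X A) y := by
  rw [mCirc_apply]
  exact le_iSup (fun B : {B // mult T X B = mult T X A} => matExt T a B.1 y) ⟨A, rfl⟩

theorem mCirc_mul_le_kleisli {X Y Z : Type u} (b : VMat V (T.obj Y) Z) (a : VMat V (T.obj X) Y)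
    (x : T.obj X) (y : T.obj Y) (z : Z) : mCirc T a x y * b y z ≤ kleisli T b a x z :=
  le_iSup (fun y => mCirc T a x y * b y z) y

theorem matExt_mul_le_kleisli {X Y Z : Type u} (b : VMat V (T.obj Y) Z)
    (a : VMat V (T.obj X) Y) (A : T.obj (T.obj X)) (y : T.obj Y) (z : Z) :
    matExt T a A y * b y z ≤ kleisli T b a (mult T X A) z :=
  (mul_le_mul_left (matExt_le_mCirc a A y) _).trans (mCirc_mul_le_kleisli b a _ y z)

/-- If `1 ≤ a (e (f y), y)` for all `y`, then `b ∗ a` is at least `b` along `T f`. -/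
theorem le_kleisli_tmap {X Y Z : Type u} {a : VMat V (T.obj X) Y} {f : Y → X}
    (h : ∀ y, 1 ≤ a (unit T X (f y)) y) (b : VMat V (T.obj Y) Z) (y : T.obj Y) (z : Z) :
    b y z ≤ kleisli T b a (tmap T f y) z := by
  have h1 := le_matExt_tmap (T := T) (g := fun y : Y => y) h y
  rw [tmap_id_apply] at h1
  have h2 := matExt_mul_le_kleisli b a (tmap T (fun y => unit T X (f y)) y) y z
  rw [← tmap_comp_apply, mult_tmap_unit] at h2
  rw [← tmap_comp_apply] at h1
  exact (le_mul_of_one_le_left' h1).trans h2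

theorem mCirc_unit_le (hT : FunctorBC T.toFunctor) (hm : NatTransBC T.μ)
    [Subsingleton (T.obj PUnit.{u + 1})] {Y : Type u} (a : VMat V (T.obj Y) V) (y : Y)
    (w : T.obj V) : mCirc T a (unit T Y y) w ≤ xi T V (tmap T (a (unit T Y y)) w) := by
  rw [mCirc_apply]
  refine iSup_le fun A => ?_
  rw [eq_unit_unit_of_mult_eq hm A.2]
  exact matExt_unit_le hT a _ w

/-- Apply `hHopf` to the image of `x` under `a ↦ (c, f a)`, using that `ξ` of a constant family at
`c` is at least `c`. -/
theorem mul_xi_tmap_le (hT : FunctorBC T.toFunctor)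
    (hHopf : ∀ w : T.obj (V × V), xi T V (tmap T Prod.fst w) * xi T V (tmap T Prod.snd w) =
      xi T V (tmap T (fun z : V × V => z.1 * z.2) w))
    {X : Type u} {f g : X → V} {c : V} (h : ∀ x, c * f x ≤ g x) (x : T.obj X) :
    c * xi T V (tmap T f x) ≤ xi T V (tmap T g x) := by
  have H := hHopf (tmap T (fun a => (c, f a)) x)
  rw [tmap_comp_apply, tmap_comp_apply, tmap_comp_apply] at H
  exact (mul_le_mul_left (le_xi_tmap_const c x) _).trans (H.le.trans (xi_tmap_mono hT h x))

theorem homXi_apply (w : T.obj V) (v : V) : homXi T V w v = homMat V (xi T V w) v :=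
  comp_graph _ _ _ _

theorem lowerStar_apply {X Y : Type u} (b : VMat V (T.obj Y) Y) (f : X → Y) (x : T.obj X)
    (y : Y) : lowerStar T b f x y = b (tmap T f x) y :=
  comp_graph _ _ _ _

theorem upperStar_apply {X Y : Type u} (b : VMat V (T.obj Y) Y) (f : X → Y) (y : T.obj Y)
    (x : X) : upperStar T b f y x = b y (f x) :=
  comp_transpose_graph _ _ _ _

/-- Through `hM`, transitivity becomes the composition law of `hom`. -/
theorem isTVCat_homXi (hT : ¬ IsTrivialMonad T) [Subsingleton (T.obj PUnit.{u + 1})]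
    (hM : ∀ v w : T.obj V, mCirc T (homXi T V) v w = homMat V (xi T V v) (xi T V w)) :
    IsTVCat T (homXi T V) where
  refl v := by rw [homXi_apply, xi_unit hT, le_homMat_iff, mul_one]
  trans A w v := by
    rw [homXi_apply, homXi_apply]
    refine (mul_le_mul_left (matExt_le_mCirc _ A w) _).trans ?_
    rw [hM]
    exact homMat_mul_homMat_le _ _ _

/-- Every right adjoint bimodule out of `(V, hom_ξ)` is represented by its values at `e 1`. -/
theorem IsAdjoint.eq_homXi (hT : ¬ IsTrivialMonad T) (hTBC : FunctorBC T.toFunctor)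
    (hmBC : NatTransBC T.μ) [Subsingleton (T.obj PUnit.{u + 1})]
    (hHopf : ∀ w : T.obj (V × V), xi T V (tmap T Prod.fst w) * xi T V (tmap T Prod.snd w) =
      xi T V (tmap T (fun z : V × V => z.1 * z.2) w))
    (hM : ∀ v w : T.obj V, mCirc T (homXi T V) v w = homMat V (xi T V v) (xi T V w))
    {Y : Type u} {b : VMat V (T.obj Y) Y} (hb : ∀ y, 1 ≤ b (unit T Y y) y)
    {φ : VMat V (T.obj Y) V} {ψ : VMat V (T.obj V) Y} (h : IsAdjoint T b (homXi T V) φ ψ)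
    (w : T.obj V) (y : Y) : ψ w y = homXi T V w (ψ (unit T V 1) y) := by
  have hψ : ∀ w w' : T.obj V, homMat V (xi T V w) (xi T V w') * ψ w' y ≤ ψ w y := fun w w' => by
    rw [← hM]
    exact (mCirc_mul_le_kleisli ψ _ w w' y).trans (h.right_bimodule.right_le w y)
  rw [homXi_apply]
  set c := ψ (unit T V 1) y
  apply le_antisymm
  · have := hψ (unit T V 1) w
    rwa [xi_unit hT, homMat_one_left, ← le_homMat_iff] at this
  · have hφ : ∀ v, c * φ (unit T Y y) v ≤ v := fun v => by
      have h1 := matExt_mul_le_kleisli φ ψ (unit T _ (unit T V 1)) (unit T Y y) v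
      rw [mult_unit] at h1
      have h2 := ((mul_le_mul_left (le_matExt_unit ψ (unit T V 1) y) _).trans h1).trans
        (h.counit_le _ v)
      rwa [homXi_apply, xi_unit hT, homMat_one_left] at h2
    -- Multiplying `hom (ξ w) c` by this join leaves, for each `w'`, the bound `hom (ξ w) c ⊗ (T φ ·
    -- m°) (e y) w' ≤ hom (ξ w) (ξ w')`.
    have hu : 1 ≤ ⨆ w', mCirc T φ (unit T Y y) w' * ψ w' y := (hb y).trans (h.unit_le _ y)
    refine (le_mul_of_one_le_right' hu).trans ?_
    rw [Quantale.mul_iSup_distrib]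
    refine iSup_le fun w' => le_trans ?_ (hψ w w')
    rw [← mul_assoc]
    refine mul_le_mul_left (le_homMat_iff.2 ?_) _
    rw [← mul_assoc]
    refine (mul_le_mul' (mul_homMat_le _ _) (mCirc_unit_le hTBC hmBC φ y w')).trans ?_
    refine (mul_xi_tmap_le hTBC hHopf (g := fun v => v) hφ w').trans ?_
    rw [tmap_id_apply]

/-- An adjoint pair whose right adjoint is represented by a map `f` is induced by `f`. -/
theorem IsAdjoint.isInducedBy {X Y : Type u} {a : VMat V (T.obj X) X} {b : VMat V (T.obj Y) Y}
    (ha : ∀ x, 1 ≤ a (unit T X x) x) (hb : ∀ y, 1 ≤ b (unit T Y y) y)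
    {φ : VMat V (T.obj Y) X} {ψ : VMat V (T.obj X) Y} (h : IsAdjoint T b a φ ψ) {f : Y → X}
    (hf : ∀ w y, ψ w y = a w (f y)) : IsInducedBy T b a φ ψ f := by
  have hψ : ∀ y, 1 ≤ ψ (unit T X (f y)) y := fun y => by
    rw [hf]
    exact ha _
  have hφ : ∀ y, 1 ≤ φ (unit T Y y) (f y) := fun y => by
    -- Since `ψ w y = a w (f y)`, the value of `ψ ∗ φ` at `(e y, y)` is that of `a ∗ φ` at `(e y, f
    -- y)`.
    refine (hb y).trans ((h.unit_le _ y).trans (le_trans ?_ (h.left_bimodule.left_le _ (f y))))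
    refine iSup_le fun w => ?_
    rw [hf]
    exact mCirc_mul_le_kleisli a φ _ w _
  refine ⟨fun A y => ?_, funext₂ fun A x => ?_, funext₂ fun w y => ?_⟩
  · rw [← hf]
    exact (le_kleisli_tmap hψ b A y).trans (h.right_bimodule.left_le _ y)
  · rw [lowerStar_apply]
    apply le_antisymm
    · have h1 := le_matExt_tmap (T := T) hφ A
      have h2 := matExt_mul_le_kleisli a φ (tmap T (unit T Y) A) (tmap T f A) x
      rw [mult_tmap_unit] at h2
      exact ((le_mul_of_one_le_left' h1).trans h2).trans (h.left_bimodule.left_le A x)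
    -- Here `φ A x ≤ (φ ∗ ψ) (T f A) x ≤ a (T f A) x`.
    · exact (le_kleisli_tmap hψ φ A x).trans (h.counit_le _ x)
  · rw [upperStar_apply, hf]

end Extension
end TVCategory
open TVCategory
theorem theorem3p4 {V : Type u} [CommMonoid V] [CompleteLattice V] [IsQuantale V]
    (hV : (1 : V) ≠ ⊥) (hccd : IsCCD V)
    (T : CategoryTheory.Monad (Type u)) (hT : ¬ IsTrivialMonad T)
    (hTBC : FunctorBC T.toFunctor) (hmBC : NatTransBC T.μ)
    (hT1 : Nonempty (T.obj PUnit.{u + 1} ≃ PUnit.{u + 1}))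
    (hHopf : ∀ w : T.obj (V × V),
      xi T V (tmap T Prod.fst w) * xi T V (tmap T Prod.snd w) =
        xi T V (tmap T (fun z : V × V => z.1 * z.2) w))
    (hM : mCirc T (homXi T V) =
      comp (transpose (graph V (xi T V))) (comp (homMat V) (graph V (xi T V)))) :
    IsTVCat T (homXi T V) ∧
    IsLawvereComplete T (homXi T V) ∧
    ∀ (φ : VMat V (T.obj PUnit.{u + 1}) V) (ψ : VMat V (T.obj V) PUnit.{u + 1}),
      IsAdjoint T (point T V) (homXi T V) φ ψ →
        IsInducedBy T (point T V) (homXi T V) φ ψ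
          (fun _ => ψ (unit T V 1) PUnit.unit) := by
  have : Subsingleton (T.obj PUnit.{u + 1}) := hT1.some.subsingleton
  have hM' : ∀ v w : T.obj V, mCirc T (homXi T V) v w = homMat V (xi T V v) (xi T V w) :=
    fun v w => by rw [hM, comp_transpose_graph, comp_graph]
  have hcat := isTVCat_homXi hT hM'
  refine ⟨hcat, fun Y b hb φ ψ h => ⟨fun y => ψ (unit T V 1) y, ?_⟩, fun φ ψ h => ?_⟩
  · exact h.isInducedBy hcat.refl hb.refl (h.eq_homXi hT hTBC hmBC hHopf hM' hb.refl)
  · have hp : ∀ y, 1 ≤ point T V (unit T PUnit.{u + 1} y) y := fun y => by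
      simp [point, transpose, graph]
    exact h.isInducedBy hcat.refl hp (h.eq_homXi hT hTBC hmBC hHopf hM' hp)
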